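/- Let $K$ be an algebraically closed field and let $\Lambda = KQ/I$ be a basic finite dimensional $K$-algebra, where $Q$ is a finite quiver and $I$ is an admissible ideal of the path algebra $KQ$ (that is, $I$ is a two-sided ideal contained in the span of the paths of length at least $2$ and containing all paths of length at least $m$, for some $m$). Let $J$ be the Jacobson radical of $\Lambda$ and let $L \ge 0$ be minimal with $J^{L+1} = 0$. For each vertex $i$ of $Q$, let $e_i$ be the primitive idempotent of $\Lambda$ given by the path of length zero at $i$. For $\mathbf d = (d_i)_{i \in Q_0}$ with $d_i \in \mathbb Z_{\ge 0}$, let $\mathrm{Rep}_{\mathbf d}(\Lambda)$ be the affine variety of all families $(x_\alpha)_{\alpha \in Q_1}$ in $\prod_{\alpha : i \to j} \mathrm{Hom}_K(K^{d_i}, K^{d_j})$ that satisfy all relations in $I$, with the Zariski topology. A point $x$ encodes the left $\Lambda$-module $M_x$ with underlying space $\bigoplus_i K^{d_i}$ on which each arrow $\alpha$ acts by $x_\alpha$. The group $\mathrm{GL}(\mathbf d) = \prod_i \mathrm{GL}_{d_i}(K)$ acts on $\mathrm{Rep}_{\mathbf d}(\Lambda)$ by conjugation. Let $\mathbb S = (\mathbb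 S_0, \dots, \mathbb S_L)$ be a sequence of finite dimensional semisimple left $\Lambda$-modules with dimension vector $\mathbf d$, that is, $\sum_{l=0}^{L} \dim_K e_i \mathbb S_l = d_i$ for every vertex $i$. An $\mathbb S$-filtration of a $\Lambda$-module $M$ is a chain of submodules $M = M_0 \supseteq M_1 \supseteq \cdots \supseteq M_{L+1} = 0$ with $M_l / M_{l+1} \cong \mathbb S_l$ for $0 \le l \le L$. Let $\mathrm{Filt}\, \mathbb S \subseteq \mathrm{Rep}_{\mathbf d}(\Lambda)$ be the set of the points $x$ such that $M_x$ has an $\mathbb S$-filtration, and let $\mathrm{Rep}\, \mathbb S \subseteq \mathrm{Rep}_{\mathbf d}(\Lambda)$ be the set of the points $x$ such that $M_x$ has radical layering $\mathbb S$, that is, $J^l M_x / J^{l+1} M_x \cong \mathbb S_l$ for $0 \le l \le L$. Then $\mathrm{Filt}\, \mathbb S$ is stable under $\mathrm{GL}(\mathbf d)$ and is a closed subset of $\mathrm{Rep}_{\mathbf d}(\Lambda)$. In particular, $\overline{\mathrm{Rep}\, \mathbb S} \subseteq \mathrm{Filt}\, \mathbb S$; that is, for every $x \in \overline{\mathrm{Rep}\,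 \mathbb S}$ the module $M_x$ has an $\mathbb S$-filtration. -/

import Mathlib

/-! ### Path algebras -/

/-- A path in a quiver, bundled with its source and target: `⟨source, target, path⟩`. -/
abbrev QuiverPath (V : Type*) [Quiver V] := Σ i j : V, Quiver.Path i j

/-- The path algebra `KQ`: the `K`-vector space with basis the set of all paths of the quiver. -/
def PathAlgebra (K : Type*) [Field K] (V : Type*) [Quiver V] := QuiverPath V →₀ K

namespace PathAlgebra

variable (K : Type*) [Field K] {V : Type*} [Quiver V]

noncomputable instance : AddCommGroup (PathAlgebra K V) :=
  inferInstanceAs (AddCommGroup (QuiverPath V →₀ K))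

noncomputable instance : Module K (PathAlgebra K V) :=
  inferInstanceAs (Module K (QuiverPath V →₀ K))

/-- The basis element of `KQ` given by a path. -/
noncomputable def ofPath (p : QuiverPath V) : PathAlgebra K V :=
  (Finsupp.single p (1 : K) : QuiverPath V →₀ K)

/-- The `K`-linear map out of `KQ` with prescribed values on paths. -/
noncomputable def lin {W : Type*} [AddCommGroup W] [Module K W] (f : QuiverPath V → W) :
    PathAlgebra K V →ₗ[K] W :=
  (Finsupp.linearCombination K f : (QuiverPath V →₀ K) →ₗ[K] W)

@[simp] theorem lin_ofPath {W : Type*} [AddCommGroup W] [Module K W] (f : QuiverPath V → W)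
    (p : QuiverPath V) : lin K f (ofPath K p) = f p :=
  (Finsupp.linearCombination_single K (1 : K) p).trans (one_smul K (f p))

variable {K} in
theorem induction {P : PathAlgebra K V → Prop} (f : PathAlgebra K V) (h0 : P 0)
    (hadd : ∀ f g, P f → P g → P (f + g)) (hsmul : ∀ (c : K) f, P f → P (c • f))
    (hpath : ∀ p, P (ofPath K p)) : P f := by
  refine Finsupp.induction_linear (motive := P) f h0 hadd fun p c => ?_
  have h : (Finsupp.single p c : QuiverPath V →₀ K) = c • Finsupp.single p (1 : K) := by simp
  rw [h]
  exact hsmul c _ (hpath p)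

section Mul

variable [DecidableEq V]

/-- The product `p q` of two paths is "`p` after `q`" if `q` ends where `p` starts,
and `0` otherwise. -/
noncomputable def mulPath (p q : QuiverPath V) : PathAlgebra K V :=
  if h : q.2.1 = p.1 then ofPath K ⟨q.1, p.2.1, q.2.2.comp (p.2.2.cast h.symm rfl)⟩ else 0

theorem mulPath_comp {i j k : V} (p : Quiver.Path j k) (q : Quiver.Path i j) :
    mulPath K ⟨j, k, p⟩ ⟨i, j, q⟩ = ofPath K ⟨i, k, q.comp p⟩ := by
  simp [mulPath]

theorem mulPath_of_ne {p q : QuiverPath V} (h : q.2.1 ≠ p.1) : mulPath K p q = 0 := by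
  simp [mulPath, h]

/-- The multiplication of `KQ`: the bilinear extension of the product of paths. -/
noncomputable def mulLin : PathAlgebra K V →ₗ[K] PathAlgebra K V →ₗ[K] PathAlgebra K V :=
  lin K fun p => lin K fun q => mulPath K p q

@[simp] theorem mulLin_ofPath (p q : QuiverPath V) :
    mulLin K (ofPath K p) (ofPath K q) = mulPath K p q := by
  simp [mulLin]

variable {K} in
theorem mulLin_assoc (f g h : PathAlgebra K V) :
    mulLin K (mulLin K f g) h = mulLin K f (mulLin K g h) := by
  induction f using induction with
  | h0 => simp
  | hadd f₁ f₂ h₁ h₂ => simp [h₁, h₂]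
  | hsmul c f₁ h₁ => simp [h₁]
  | hpath p =>
  induction g using induction with
  | h0 => simp
  | hadd f₁ f₂ h₁ h₂ => simp [h₁, h₂]
  | hsmul c f₁ h₁ => simp [h₁]
  | hpath q =>
  induction h using induction with
  | h0 => simp only [map_zero]
  | hadd f₁ f₂ h₁ h₂ => simp only [map_add, h₁, h₂]
  | hsmul c f₁ h₁ => simp only [map_smul, h₁]
  | hpath r =>
  obtain ⟨p₁, p₂, p⟩ := p
  obtain ⟨q₁, q₂, q⟩ := q
  obtain ⟨r₁, r₂, r⟩ := r
  simp only [mulLin_ofPath]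
  by_cases hpq : q₂ = p₁
  · subst hpq
    by_cases hqr : r₂ = q₁
    · subst hqr
      simp [mulPath_comp]
    · rw [mulPath_comp, mulLin_ofPath, mulPath_of_ne K (p := ⟨q₁, q₂, q⟩) hqr,
        mulPath_of_ne K hqr, map_zero]
  · rw [mulPath_of_ne K (p := ⟨p₁, p₂, p⟩) (q := ⟨q₁, q₂, q⟩) hpq]
    by_cases hqr : r₂ = q₁
    · subst hqr
      rw [mulPath_comp, mulLin_ofPath, mulPath_of_ne K hpq]
      simp
    · rw [mulPath_of_ne K (p := ⟨q₁, q₂, q⟩) hqr]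
      simp

variable [Fintype V]

/-- The unit element of `KQ`: the sum of the paths of length zero. -/
noncomputable def unit : PathAlgebra K V := ∑ i : V, ofPath K ⟨i, i, Quiver.Path.nil⟩

variable {K} in
theorem unit_mulLin (f : PathAlgebra K V) : mulLin K (unit K) f = f := by
  induction f using induction with
  | h0 => simp
  | hadd f₁ f₂ h₁ h₂ => simp [h₁, h₂]
  | hsmul c f₁ h₁ => simp [h₁]
  | hpath p =>
  obtain ⟨i, j, p⟩ := p
  rw [unit, map_sum, LinearMap.sum_apply, Finset.sum_eq_single j]
  · simp [mulPath_comp]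
  · intro k _ hk
    rw [mulLin_ofPath, mulPath_of_ne K hk.symm]
  · simp

variable {K} in
theorem mulLin_unit (f : PathAlgebra K V) : mulLin K f (unit K) = f := by
  induction f using induction with
  | h0 => simp
  | hadd f₁ f₂ h₁ h₂ => simp [h₁, h₂]
  | hsmul c f₁ h₁ => simp [h₁]
  | hpath p =>
  obtain ⟨i, j, p⟩ := p
  rw [unit, map_sum, Finset.sum_eq_single i]
  · simp [mulPath_comp]
  · intro k _ hk
    rw [mulLin_ofPath, mulPath_of_ne K hk]
  · simp

noncomputable instance : Ring (PathAlgebra K V) :=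
  { (inferInstance : AddCommGroup (PathAlgebra K V)) with
    mul := fun f g => mulLin K f g
    one := unit K
    left_distrib := fun f g h => map_add (mulLin K f) g h
    right_distrib := fun f g h => LinearMap.map_add₂ (mulLin K) f g h
    zero_mul := fun f => LinearMap.map_zero₂ (mulLin K) f
    mul_zero := fun f => map_zero (mulLin K f)
    mul_assoc := mulLin_assoc
    one_mul := unit_mulLin
    mul_one := mulLin_unit }

noncomputable instance : Algebra K (PathAlgebra K V) :=
  Algebra.ofModule (fun c f g => LinearMap.map_smul₂ (mulLin K) c f g)
    (fun c f g => map_smul (mulLin K f) c g)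

variable {K} in
theorem ofPath_mul_ofPath (p q : QuiverPath V) :
    ofPath K p * ofPath K q = mulPath K p q :=
  mulLin_ofPath K p q

variable (V) in
theorem one_def : (1 : PathAlgebra K V) = ∑ i : V, ofPath K ⟨i, i, Quiver.Path.nil⟩ := rfl

end Mul

end PathAlgebra

section

variable {K : Type*} [Field K] {V : Type*} [Fintype V] [DecidableEq V] [Quiver V]

/-- Admissible ideals `I` of `KQ`: `I` lies in the span of the paths of length at least `2`,
and it contains all paths of length at least `m`, for some `m`. -/
structure IsAdmissibleIdeal (I : Ideal (PathAlgebra K V)) : Prop where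
  le_span : ∀ r ∈ I, r ∈ Submodule.span K
    {s : PathAlgebra K V | ∃ p : QuiverPath V, 2 ≤ p.2.2.length ∧ s = PathAlgebra.ofPath K p}
  exists_long_paths_mem : ∃ m : ℕ, ∀ p : QuiverPath V,
    m ≤ p.2.2.length → PathAlgebra.ofPath K p ∈ I

variable (I : Ideal (PathAlgebra K V)) [I.IsTwoSided]

/-- The number `L`, minimal with `J ^ (L + 1) = 0`, where `J` is the Jacobson radical of
`Λ = KQ / I`; so `L + 1` is the Loewy length of `Λ` (if `Λ` is not zero). -/
noncomputable def loewyIndex : ℕ :=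
  sInf {n : ℕ | Ring.jacobson (PathAlgebra K V ⧸ I) ^ (n + 1) = ⊥}

/-- The `K`-subspace `e_i M` of a `Λ`-module `M`, where `e_i` is the primitive idempotent of
`Λ = KQ / I` given by the path of length zero at the vertex `i`. -/
noncomputable def vertexSpace (M : Type*) [AddCommGroup M] [Module K M]
    [Module (PathAlgebra K V ⧸ I) M] [IsScalarTower K (PathAlgebra K V ⧸ I) M] (i : V) :
    Submodule K M :=
  LinearMap.range (Algebra.lsmul K K M
    (Ideal.Quotient.mk I (PathAlgebra.ofPath K ⟨i, i, Quiver.Path.nil⟩)))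

/-- A sequence `(𝕊_0, …, 𝕊_L)` of finite dimensional semisimple left `Λ`-modules,
where `Λ = KQ / I`. -/
structure SemisimpleSequence where
  /-- The underlying types of the modules. -/
  obj : Fin (loewyIndex I + 1) → Type*
  [addCommGroup : ∀ l, AddCommGroup (obj l)]
  [moduleBase : ∀ l, Module K (obj l)]
  [module : ∀ l, Module (PathAlgebra K V ⧸ I) (obj l)]
  [isScalarTower : ∀ l, IsScalarTower K (PathAlgebra K V ⧸ I) (obj l)]
  [finiteDimensional : ∀ l, FiniteDimensional K (obj l)]
  [isSemisimpleModule : ∀ l, IsSemisimpleModule (PathAlgebra K V ⧸ I) (obj l)]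

attribute [instance] SemisimpleSequence.addCommGroup SemisimpleSequence.moduleBase
  SemisimpleSequence.module SemisimpleSequence.isScalarTower
  SemisimpleSequence.finiteDimensional SemisimpleSequence.isSemisimpleModule

variable {I}

/-- The dimension vector of a semisimple sequence: at the vertex `i` it is
`∑ l, dim (e_i 𝕊_l)`. -/
noncomputable def SemisimpleSequence.dimVector (S : SemisimpleSequence I) (i : V) : ℕ :=
  ∑ l, Module.finrank K (vertexSpace I (S.obj l) i)

/-- `M` has a filtration `M = M_0 ⊇ M_1 ⊇ ⋯ ⊇ M_{L+1} = 0` by submodules which is governed by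
`𝕊`, that is, `M_l / M_{l+1} ≅ 𝕊_l` for `0 ≤ l ≤ L`. -/
def SemisimpleSequence.GovernsFiltration (S : SemisimpleSequence I) (M : Type*) [AddCommGroup M]
    [Module (PathAlgebra K V ⧸ I) M] : Prop :=
  ∃ F : Fin (loewyIndex I + 1 + 1) → Submodule (PathAlgebra K V ⧸ I) M,
    F 0 = ⊤ ∧ F (Fin.last _) = ⊥ ∧ ∀ l : Fin (loewyIndex I + 1),
      F l.succ ≤ F l.castSucc ∧
      Nonempty ((F l.castSucc ⧸ (F l.succ).submoduleOf (F l.castSucc))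
        ≃ₗ[PathAlgebra K V ⧸ I] S.obj l)

/-- The radical power `J ^ l M` of a `Λ`-module `M`. -/
noncomputable def radicalPower (I : Ideal (PathAlgebra K V)) [I.IsTwoSided] (M : Type*) [AddCommGroup M]
    [Module (PathAlgebra K V ⧸ I) M] (l : ℕ) : Submodule (PathAlgebra K V ⧸ I) M :=
  (Ring.jacobson (PathAlgebra K V ⧸ I) ^ l) • ⊤

/-- The radical layering `(J ^ l M / J ^ (l + 1) M)_{0 ≤ l ≤ L}` of `M` is `𝕊`,
up to isomorphism of the entries. -/
def SemisimpleSequence.IsRadicalLayering (S : SemisimpleSequence I) (M : Type*) [AddCommGroup M]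
    [Module (PathAlgebra K V ⧸ I) M] : Prop :=
  ∀ l : Fin (loewyIndex I + 1),
    Nonempty ((radicalPower I M l ⧸
        (radicalPower I M (l + 1)).submoduleOf (radicalPower I M l))
      ≃ₗ[PathAlgebra K V ⧸ I] S.obj l)

end

/-! ### The affine space of arrow tuples, its Zariski topology, and the action of `GL(d)` -/

/-- The affine space `∏_α Hom_K(K^{d_{start α}}, K^{d_{end α}})`, in terms of matrices. -/
def ArrowTuple (K : Type*) {V : Type*} [Quiver V] (d : V → ℕ) :=
  ∀ ⦃i j : V⦄, (i ⟶ j) → Matrix (Fin (d j)) (Fin (d i)) K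

namespace ArrowTuple

variable {K : Type*} [Field K] {V : Type*} [Quiver V] {d : V → ℕ}

/-- The index set of the coordinates on the affine space of arrow tuples: matrix entries. -/
abbrev Coord (d : V → ℕ) := Σ i j : V, (i ⟶ j) × Fin (d j) × Fin (d i)

/-- The coordinates of an arrow tuple. -/
def coord (x : ArrowTuple K d) (c : Coord d) : K := x c.2.2.1 c.2.2.2.1 c.2.2.2.2

variable (K) in
/-- The common zero set of a set of polynomials in the matrix entries. -/
def zeroSet (T : Set (MvPolynomial (Coord d) K)) : Set (ArrowTuple K d) :=
  {x | ∀ f ∈ T, MvPolynomial.eval x.coord f = 0}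

/-- The Zariski topology: the closed sets are the common zero sets of sets of polynomials. -/
instance zariskiTopology : TopologicalSpace (ArrowTuple K d) :=
  TopologicalSpace.ofClosed (Set.range (zeroSet K))
    ⟨{1}, by ext x; simp [zeroSet]⟩
    (by
      intro A hA
      refine ⟨⋃₀ {T | zeroSet K T ∈ A}, ?_⟩
      ext x
      simp only [zeroSet, Set.mem_sUnion, Set.mem_ofPred_eq, Set.mem_sInter]
      constructor
      · intro h Z hZ
        obtain ⟨T, rfl⟩ := hA hZ
        exact fun f hf => h f ⟨T, hZ, hf⟩
      · rintro h f ⟨T, hT, hf⟩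
        exact h _ hT f hf)
    (by
      rintro _ ⟨T, rfl⟩ _ ⟨U, rfl⟩
      refine ⟨{h | ∃ f ∈ T, ∃ g ∈ U, h = f * g}, ?_⟩
      ext x
      simp only [zeroSet, Set.mem_ofPred_eq, Set.mem_union]
      constructor
      · intro h
        by_contra! hcon
        obtain ⟨⟨f, hf, hfx⟩, ⟨g, hg, hgx⟩⟩ := hcon
        have := h (f * g) ⟨f, hf, g, hg, rfl⟩
        rw [map_mul] at this
        exact (mul_ne_zero hfx hgx) this
      · rintro (h | h) _ ⟨f, hf, g, hg, rfl⟩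
        · rw [map_mul, h f hf, zero_mul]
        · rw [map_mul, h g hg, mul_zero])

theorem isClosed_iff {Z : Set (ArrowTuple K d)} : IsClosed Z ↔ ∃ T, zeroSet K T = Z := by
  rw [← isOpen_compl_iff]
  change Zᶜᶜ ∈ Set.range (zeroSet K) ↔ _
  rw [compl_compl]
  rfl

/-- The product of matrices given by a path; the matrix of the first arrow acts first. -/
def pathMatrix (x : ArrowTuple K d) {i : V} :
    ∀ {j : V}, Quiver.Path i j → Matrix (Fin (d j)) (Fin (d i)) K
  | _, .nil => 1
  | _, .cons p a => x a * pathMatrix x p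

theorem pathMatrix_comp (x : ArrowTuple K d) {i j k : V} (p : Quiver.Path i j)
    (q : Quiver.Path j k) : x.pathMatrix (p.comp q) = x.pathMatrix q * x.pathMatrix p := by
  induction q with
  | nil => simp [pathMatrix]
  | cons q a ih => simp [pathMatrix, ih, Matrix.mul_assoc]

/-- `GL(d) = ∏_i GL_{d_i}(K)` acts on arrow tuples by conjugation:
`(g x)_α = g_{end α} x_α g_{start α}⁻¹`. -/
instance : MulAction (∀ i : V, GL (Fin (d i)) K) (ArrowTuple K d) where
  smul g x := fun i j a => (g j).1 * x a * ((g i)⁻¹).1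
  one_smul x := by
    funext i j a
    change ((1 : GL (Fin (d j)) K)).1 * x a * ((1 : GL (Fin (d i)) K)⁻¹).1 = x a
    simp
  mul_smul g h x := by
    funext i j a
    change (g j * h j).1 * x a * ((g i * h i)⁻¹).1
      = (g j).1 * ((h j).1 * x a * ((h i)⁻¹).1) * ((g i)⁻¹).1
    simp only [mul_inv_rev, Units.val_mul, Matrix.mul_assoc]

theorem smul_apply (g : ∀ i : V, GL (Fin (d i)) K) (x : ArrowTuple K d) {i j : V} (a : i ⟶ j) :
    (g • x) a = (g j).1 * x a * ((g i)⁻¹).1 := rfl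

theorem pathMatrix_smul (g : ∀ i : V, GL (Fin (d i)) K) (x : ArrowTuple K d) {i j : V}
    (p : Quiver.Path i j) :
    (g • x).pathMatrix p * (g i).1 = (g j).1 * x.pathMatrix p := by
  induction p with
  | nil => simp [pathMatrix]
  | @cons b c p a ih =>
    have h : ((g b)⁻¹).1 * (g b).1 = 1 := (g b).inv_mul
    calc (g c).1 * x a * ((g b)⁻¹).1 * (g • x).pathMatrix p * (g i).1
        = (g c).1 * x a * (((g b)⁻¹).1 * ((g • x).pathMatrix p * (g i).1)) := by
          simp only [Matrix.mul_assoc]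
      _ = (g c).1 * (x a * x.pathMatrix p) := by
          rw [ih, ← Matrix.mul_assoc (Units.val _), h, Matrix.one_mul, Matrix.mul_assoc]

variable [DecidableEq V]

/-- The endomorphism of `∏_i K^{d_i}` given by a path: it is the product of the matrices along
the path on the component at the source (with values in the component at the target), and zero
on the other components. -/
def pathEnd (x : ArrowTuple K d) (p : QuiverPath V) :
    Module.End K (∀ i : V, Fin (d i) → K) :=
  LinearMap.single K (fun i : V => Fin (d i) → K) p.2.1 ∘ₗ
    (x.pathMatrix p.2.2).mulVecLin ∘ₗ LinearMap.proj p.1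

variable [Fintype V]

/-- The representation `KQ → End_K(∏_i K^{d_i})` of the path algebra given by an arrow tuple. -/
noncomputable def repHom (x : ArrowTuple K d) :
    PathAlgebra K V →ₐ[K] Module.End K (∀ i : V, Fin (d i) → K) :=
  AlgHom.ofLinearMap (PathAlgebra.lin K x.pathEnd)
    (by
      rw [PathAlgebra.one_def, map_sum]
      refine LinearMap.ext fun v => ?_
      funext i
      simp [pathEnd, pathMatrix, LinearMap.sum_apply, Finset.sum_apply])
    (by
      intro f g
      induction f using PathAlgebra.induction with
      | h0 => simp
      | hadd f₁ f₂ h₁ h₂ => simp [add_mul, h₁, h₂]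
      | hsmul c f₁ h₁ => simp [h₁]
      | hpath p =>
      induction g using PathAlgebra.induction with
      | h0 => simp
      | hadd f₁ f₂ h₁ h₂ => simp [mul_add, h₁, h₂]
      | hsmul c f₁ h₁ => simp [h₁]
      | hpath q =>
      obtain ⟨p₁, p₂, p⟩ := p
      obtain ⟨q₁, q₂, q⟩ := q
      rw [PathAlgebra.ofPath_mul_ofPath]
      refine LinearMap.ext fun v => ?_
      by_cases h : q₂ = p₁
      · subst h
        rw [PathAlgebra.mulPath_comp]
        simp [pathEnd, pathMatrix_comp]
      · rw [PathAlgebra.mulPath_of_ne K h]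
        simp [pathEnd, Pi.single_eq_of_ne (Ne.symm h)])

@[simp] theorem repHom_ofPath (x : ArrowTuple K d) (p : QuiverPath V) :
    x.repHom (PathAlgebra.ofPath K p) = x.pathEnd p :=
  PathAlgebra.lin_ofPath K x.pathEnd p

theorem repHom_smul (g : ∀ i : V, GL (Fin (d i)) K) (x : ArrowTuple K d) (r : PathAlgebra K V)
    (v : ∀ i : V, Fin (d i) → K) :
    (g • x).repHom r (fun i => (g i).1.mulVec (v i)) =
      fun i => (g i).1.mulVec (x.repHom r v i) := by
  induction r using PathAlgebra.induction with
  | h0 => funext i; simp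
  | hadd f₁ f₂ h₁ h₂ => funext i; simp [h₁, h₂, Matrix.mulVec_add]
  | hsmul c f₁ h₁ => funext i; simp [h₁, Matrix.mulVec_smul]
  | hpath p =>
    obtain ⟨j, k, p⟩ := p
    funext i
    by_cases h : i = k
    · subst h
      simp [pathEnd, pathMatrix_smul]
    · simp [pathEnd, Pi.single_eq_of_ne h]

end ArrowTuple

/-! ### The variety `Rep_d(Λ)` -/

section

variable {K : Type*} [Field K] {V : Type*} [Fintype V] [DecidableEq V] [Quiver V]

/-- The affine variety `Rep_d(Λ)`, for `Λ = KQ / I`: the arrow tuples that satisfy all relations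
in `I`. As a type, it carries the subspace topology of the Zariski topology. -/
def RepVariety (I : Ideal (PathAlgebra K V)) (d : V → ℕ) : Set (ArrowTuple K d) :=
  {x | ∀ r ∈ I, x.repHom r = 0}

/-- `Rep_d(Λ)` is stable under the conjugation action of `GL(d)`. -/
instance (I : Ideal (PathAlgebra K V)) (d : V → ℕ) :
    MulAction (∀ i : V, GL (Fin (d i)) K) (RepVariety I d) where
  smul g x := ⟨g • x.1, by
    intro r hr
    refine LinearMap.ext fun v => ?_
    have h := x.1.repHom_smul g r (fun i => ((g i)⁻¹).1.mulVec (v i))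
    rw [x.2 r hr] at h
    have hv : (fun i => (g i).1.mulVec (((g i)⁻¹).1.mulVec (v i))) = v := by
      funext i
      rw [Matrix.mulVec_mulVec, ← Units.val_mul]
      simp
    rw [hv] at h
    rw [h]
    funext i
    simp⟩
  one_smul x := Subtype.ext (one_smul _ x.1)
  mul_smul g h x := Subtype.ext (mul_smul g h x.1)

variable {I : Ideal (PathAlgebra K V)} {d : V → ℕ}

/-- The `Λ`-module `M_x` given by a point `x` of `Rep_d(Λ)`: the space `∏_i K^{d_i}`, on which
the class of a path acts by `ArrowTuple.pathEnd`. -/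
def RepModule (_x : RepVariety I d) := ∀ i : V, Fin (d i) → K

namespace RepModule

variable (x : RepVariety I d)

instance : AddCommGroup (RepModule x) :=
  inferInstanceAs (AddCommGroup (∀ i : V, Fin (d i) → K))

instance : Module K (RepModule x) :=
  inferInstanceAs (Module K (∀ i : V, Fin (d i) → K))

variable [I.IsTwoSided]

noncomputable instance : Module (PathAlgebra K V ⧸ I) (RepModule x) :=
  Module.compHom (∀ i : V, Fin (d i) → K)
    (Ideal.Quotient.liftₐ I x.1.repHom x.2).toRingHom

theorem mk_smul (r : PathAlgebra K V) (v : RepModule x) :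
    (Ideal.Quotient.mk I r • v : RepModule x) = x.1.repHom r v := rfl

end RepModule

variable [I.IsTwoSided]

variable (d) in
/-- `Rep 𝕊`: the points `x` of `Rep_d(Λ)` such that `M_x` has radical layering `𝕊`. -/
def SemisimpleSequence.rep (S : SemisimpleSequence I) : Set (RepVariety I d) :=
  {x | S.IsRadicalLayering (RepModule x)}

variable (d) in
/-- `Filt 𝕊`: the points `x` of `Rep_d(Λ)` such that `M_x` has a filtration governed by `𝕊`. -/
def SemisimpleSequence.filt (S : SemisimpleSequence I) : Set (RepVariety I d) :=
  {x | S.GovernsFiltration (RepModule x)}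

end

/-!
A point `x` lies in `Filt 𝕊` if and only if there are subspaces `U_{i,l}` of `K ^ d_i`, decreasing
in `l`, of the dimensions that `𝕊` prescribes, such that each arrow `i → j` maps `U_{i,l}` into
`U_{j,l+1}` (`SemisimpleSequence.mem_filt_iff`). Indeed, arrows lie in the Jacobson radical, so they
annihilate semisimple modules (`mk_ofPath_smul_eq_zero`), and a module annihilated by the arrows is
determined by its dimension vector (`nonempty_linearEquiv_of_finrank_vertexSpace_eq`). Such
subspaces form a subrepresentation, of fixed dimension vector, of a representation of the larger
quiver with vertices `(i, l)`; the matrices of this representation are the `x_α` and identity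
matrices.

It remains to see that, in a polynomial family of representations, those with a subrepresentation
of given dimension vector form a Zariski closed set. This is the properness of the quiver
Grassmannian over the parameter space, and the proof is the valuative one. Subrepresentations over
all points of the locus `Z` give one over the ring of functions `Z → K`, and hence over a field `F`
that is the fraction field of a quotient of this ring. If `x` satisfies the equations of `Z`, then
the quotient can be chosen such that the `F`-valued point specializes to `x`
(`HasSubrep.eval_of_forall_eval_eq_zero`). The subrepresentation extends to a valuation ring of `F`
that dominates the local ring at `x` (`HasSubrep.of_valuationSubring`), so it exists over the
residue field, and by the Nullstellensatz it exists over `K` as well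
(`HasSubrep.of_field_extension`).

Since the Jacobson radical `J` of the finite dimensional algebra `Λ` is nilpotent, the submodules
`J ^ l M` form a filtration that ends in `0`. So `Rep 𝕊` is contained in the closed set `Filt 𝕊`,
and the closure of `Rep 𝕊` is, too.
-/

/-! ### Subrepresentations with free complement, and change of rings -/

/-- Matrices `X τ : R ^ n (s τ) → R ^ n (t τ)` form a representation of the quiver with vertices
`E` and arrows `s τ → t τ`. The predicate says that it has a subrepresentation of dimension vector
`D` whose member at each vertex `e` is spanned by the first `D e` vectors of some basis of
`R ^ n e`: the columns of `g e` are the basis, and `h e` is the inverse of `g e`. Over a field, and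
for `D ≤ n`, it says that the quiver Grassmannian of the representation is not empty. -/
def HasSubrep {E T : Type*} {n : E → ℕ} (D : E → ℕ) {s t : T → E} {R : Type*} [CommRing R]
    (X : ∀ τ, Matrix (Fin (n (t τ))) (Fin (n (s τ))) R) : Prop :=
  ∃ g h : ∀ e, Matrix (Fin (n e)) (Fin (n e)) R, (∀ e, h e * g e = 1) ∧
    ∀ τ (a : Fin (n (t τ))) (b : Fin (n (s τ))), (b : ℕ) < D (s τ) → D (t τ) ≤ (a : ℕ) →
      (h (t τ) * X τ * g (s τ)) a b = 0

namespace HasSubrep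

variable {E T : Type*} {n D : E → ℕ} {s t : T → E}

theorem map {R R' : Type*} [CommRing R] [CommRing R']
    {X : ∀ τ, Matrix (Fin (n (t τ))) (Fin (n (s τ))) R} (hX : HasSubrep D X) (f : R →+* R') :
    HasSubrep D fun τ => (X τ).map f := by
  obtain ⟨g, h, hg, hX⟩ := hX
  refine ⟨fun e => (g e).map f, fun e => (h e).map f, fun e => ?_, fun τ a b hb ha => ?_⟩
  · rw [← Matrix.map_mul, hg, Matrix.map_one f f.map_zero f.map_one]
  · rw [← Matrix.map_mul, ← Matrix.map_mul, Matrix.map_apply, hX τ a b hb ha, map_zero]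

/-- A subrepresentation for each `z : Z` is a subrepresentation over the ring of functions. -/
theorem pi {R Z : Type*} [CommRing R] {X : ∀ τ, Matrix (Fin (n (t τ))) (Fin (n (s τ))) (Z → R)}
    (hX : ∀ z, HasSubrep D fun τ => (X τ).map fun f => f z) : HasSubrep D X := by
  choose g h hg hX using hX
  refine ⟨fun e => .of fun a b z => g z e a b, fun e => .of fun a b z => h z e a b,
    fun e => ?_, fun τ a b hb ha => ?_⟩
  · ext a b z
    have := congrFun (congrFun (hg z e) a) b
    simp only [Matrix.mul_apply, Finset.sum_apply, Pi.mul_apply, Matrix.of_apply] at this ⊢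
    rw [this]
    by_cases hab : a = b <;> simp [hab, Matrix.one_apply]
  · ext z
    have := hX z τ a b hb ha
    simpa only [Matrix.mul_apply, Finset.sum_apply, Pi.mul_apply, Matrix.of_apply,
      Matrix.map_apply, Pi.zero_apply] using this

end HasSubrep

/-- Over a valuation ring, invertible row operations bring each matrix with entries in the
fraction field to triangular form: the pivot of a column is an entry of largest valuation. -/
theorem ValuationSubring.exists_units_mul_blockTriangular {F : Type*} [Field F]
    (B : ValuationSubring F) {n : ℕ} (g : Matrix (Fin n) (Fin n) F) :
    ∃ u : (Matrix (Fin n) (Fin n) B)ˣ,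
      (((u : Matrix (Fin n) (Fin n) B).map B.subtype) * g).BlockTriangular id := by
  suffices H : ∀ k ≤ n, ∃ u : (Matrix (Fin n) (Fin n) B)ˣ, ∀ a b : Fin n, b < a → (b : ℕ) < k →
      (((u : Matrix (Fin n) (Fin n) B).map B.subtype) * g) a b = 0 by
    obtain ⟨u, hu⟩ := H n le_rfl
    exact ⟨u, fun a b hab => hu a b hab b.2⟩
  intro k
  induction k with
  | zero => exact fun _ => ⟨1, fun a b _ h => absurd h (Nat.not_lt_zero _)⟩
  | succ k ih =>
    intro hk
    obtain ⟨u, hu⟩ := ih (by omega)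
    set G := ((u : Matrix (Fin n) (Fin n) B).map B.subtype) * g with hG
    let c : Fin n := ⟨k, hk⟩
    obtain ⟨p, hp, hmax⟩ := (Finset.Ici c).exists_max_image (fun a => B.valuation (G a c))
      ⟨c, by simp⟩
    rw [Finset.mem_Ici] at hp
    -- the multipliers of the elimination, after the pivot row `p` has been swapped with row `c`
    have hmem : ∀ a, c ≤ a → G a c / G p c ∈ B := by
      intro a ha
      by_cases h0 : G p c = 0
      · simp [h0]
      · rw [← B.valuation_le_one_iff, map_div₀]
        exact (div_le_one₀ (zero_lt_iff.2 ((map_ne_zero _).2 h0))).2 (hmax a (by simpa using ha))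
    let σ := Equiv.swap c p
    have hσ : ∀ a, c < a → c ≤ σ a := by
      intro a ha
      by_cases hap : a = p
      · simp [σ, hap]
      · rw [Equiv.swap_apply_of_ne_of_ne ha.ne' hap]; exact ha.le
    let m : Fin n → B := fun a => if ha : c < a then ⟨_, hmem (σ a) (hσ a ha)⟩ else 0
    let C : Matrix (Fin n) (Fin n) B := Matrix.vecMulVec m (Pi.single c 1)
    have hC : C * C = 0 := by
      simp [C, Matrix.vecMulVec_mul_vecMulVec, m]
    let v : (Matrix (Fin n) (Fin n) B)ˣ :=
      ⟨1 - C, 1 + C, by simp [mul_add, sub_mul, hC], by simp [add_mul, mul_sub, hC]⟩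
    let P : Matrix (Fin n) (Fin n) B := σ.toPEquiv.toMatrix
    have hP : P * P = 1 := by
      simp only [P]
      rw [← PEquiv.toMatrix_trans, ← Equiv.toPEquiv_trans]
      simp [σ]
    let w : (Matrix (Fin n) (Fin n) B)ˣ := ⟨P, P, hP, hP⟩
    have hPmap : P.map B.subtype = σ.toPEquiv.toMatrix := by
      ext a b
      simp [P, PEquiv.toMatrix_apply, apply_ite]
    have key : ∀ a b, ((((v * w * u : (Matrix (Fin n) (Fin n) B)ˣ) :
        Matrix (Fin n) (Fin n) B).map B.subtype) * g) a b =
        G (σ a) b - (if c < a then G (σ a) c / G p c else 0) * G p b := by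
      intro a b
      have e : (((v * w * u : (Matrix (Fin n) (Fin n) B)ˣ) :
          Matrix (Fin n) (Fin n) B).map B.subtype) * g =
          (G.submatrix σ id) - C.map B.subtype * G.submatrix σ id := by
        rw [Units.val_mul, Units.val_mul, Matrix.map_mul, Matrix.map_mul, Matrix.mul_assoc, ← hG]
        change (1 - C).map B.subtype * P.map B.subtype * G = _
        rw [hPmap, Matrix.mul_assoc, PEquiv.toMatrix_toPEquiv_mul, Matrix.map_sub _ (by simp),
          Matrix.map_one _ (by simp) (by simp), sub_mul, one_mul]
      rw [e]
      simp only [Matrix.sub_apply, Matrix.submatrix_apply, id, Matrix.mul_apply]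
      congr 1
      rw [Finset.sum_eq_single c]
      · simp only [C, Matrix.map_apply, Matrix.vecMulVec_apply, m, σ]
        by_cases ha : c < a <;> simp [ha]
      · intro j _ hj
        simp [C, Matrix.vecMulVec_apply, hj]
      · simp
    refine ⟨v * w * u, fun a b hba hb => ?_⟩
    rw [key]
    rcases Nat.lt_succ_iff_lt_or_eq.1 hb with hb | hb
    · have hpb : G p b = 0 := hu p b (lt_of_lt_of_le (show b < c from hb) hp) hb
      have hab : G (σ a) b = 0 := by
        refine hu _ b ?_ hb
        by_cases h1 : a = c
        · rw [h1]; simp only [σ, Equiv.swap_apply_left]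
          exact lt_of_lt_of_le (show b < c from hb) hp
        · by_cases h2 : a = p
          · rw [h2]; simpa only [σ, Equiv.swap_apply_right] using show b < c from hb
          · rwa [Equiv.swap_apply_of_ne_of_ne h1 h2]
      rw [hpb, hab]; simp
    · obtain hbc : b = c := Fin.ext hb
      rw [hbc] at hba ⊢
      rw [if_pos hba]
      by_cases h0 : G p c = 0
      · have : B.valuation (G (σ a) c) ≤ 0 := by
          simpa [h0] using hmax (σ a) (by simpa using hσ a hba)
        rw [(map_eq_zero _).1 (le_zero_iff.1 this), h0]; simp
      · rw [div_mul_cancel₀ _ h0, sub_self]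

namespace HasSubrep

variable {E T : Type*} {n D : E → ℕ} {s t : T → E}

/-- The valuative criterion of properness for quiver Grassmannians. Row operations over the
valuation ring make the basis matrices triangular, and triangular base changes preserve the spans
of the first basis vectors. -/
theorem of_valuationSubring {F : Type*} [Field F] (B : ValuationSubring F)
    {X : ∀ τ, Matrix (Fin (n (t τ))) (Fin (n (s τ))) B}
    (hX : HasSubrep D fun τ => (X τ).map B.subtype) : HasSubrep D X := by
  obtain ⟨g, h, hg, hX⟩ := hX
  choose u hu using fun e => B.exists_units_mul_blockTriangular (g e)
  refine ⟨fun e => ((u e)⁻¹ : (Matrix _ _ B)ˣ).1, fun e => (u e).1, fun e => (u e).mul_inv,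
    fun τ a b hb ha => ?_⟩
  have hinv : ∀ e, (((u e)⁻¹ : (Matrix _ _ B)ˣ).1.map B.subtype) * ((u e).1.map B.subtype) = 1 := by
    intro e
    rw [← Matrix.map_mul, (u e).inv_mul, Matrix.map_one _ (by simp) (by simp)]
  let U : ∀ e, Matrix (Fin (n e)) (Fin (n e)) F := fun e => (u e).1.map B.subtype * g e
  let U' : ∀ e, Matrix (Fin (n e)) (Fin (n e)) F :=
    fun e => h e * ((u e)⁻¹ : (Matrix _ _ B)ˣ).1.map B.subtype
  have hUU' : ∀ e, U e * U' e = 1 := by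
    intro e
    rw [mul_eq_one_comm]
    change h e * _ * (_ * g e) = 1
    rw [Matrix.mul_assoc, ← Matrix.mul_assoc _ _ (g e), hinv, Matrix.one_mul, hg]
  have hU' : ∀ e, (U' e).BlockTriangular id := by
    intro e
    have := invertibleOfRightInverse _ _ (hUU' e)
    rw [← Matrix.inv_eq_right_inv (hUU' e)]
    exact Matrix.blockTriangular_inv_of_blockTriangular (hu e)
  have e1 : ((u (t τ)).1 * X τ * ((u (s τ))⁻¹ : (Matrix _ _ B)ˣ).1).map B.subtype =
      U (t τ) * (h (t τ) * (X τ).map B.subtype * g (s τ)) * U' (s τ) := by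
    have h1 : g (t τ) * h (t τ) = 1 := mul_eq_one_comm.1 (hg _)
    have h2 : g (s τ) * h (s τ) = 1 := mul_eq_one_comm.1 (hg _)
    rw [Matrix.map_mul, Matrix.map_mul]
    simp only [U, U', Matrix.mul_assoc]
    rw [← Matrix.mul_assoc (g (s τ)), h2, Matrix.one_mul, ← Matrix.mul_assoc (g (t τ)), h1,
      Matrix.one_mul]
  have e2 : (((u (t τ)).1 * X τ * ((u (s τ))⁻¹ : (Matrix _ _ B)ˣ).1) a b : F) = 0 := by
    have := congrFun (congrFun e1 a) b
    rw [Matrix.map_apply] at this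
    refine this.trans ?_
    rw [Matrix.mul_apply]
    refine Finset.sum_eq_zero fun c _ => ?_
    by_cases hc : b < c
    · rw [hU' _ (show id b < id c from hc), mul_zero]
    rw [Matrix.mul_apply, Finset.sum_eq_zero, zero_mul]
    intro c' _
    by_cases hc' : c' < a
    · rw [show U (t τ) a c' = 0 from hu _ (show id c' < id a from hc'), zero_mul]
    · rw [hX τ c' c (lt_of_le_of_lt (Fin.le_def.1 (not_lt.1 hc)) hb)
        (ha.trans (Fin.le_def.1 (not_lt.1 hc'))), mul_zero]
  exact Subtype.ext e2

end HasSubrep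

/-- A nonzero algebra of finite type over an algebraically closed field has a rational point. -/
theorem IsAlgClosed.nonempty_algHom_of_finiteType (K A : Type*) [Field K] [IsAlgClosed K]
    [CommRing A] [Nontrivial A] [Algebra K A] [Algebra.FiniteType K A] :
    Nonempty (A →ₐ[K] K) := by
  obtain ⟨m, hm⟩ := Ideal.exists_maximal A
  let _ : Field (A ⧸ m) := Ideal.Quotient.field m
  have : Algebra.FiniteType K (A ⧸ m) :=
    .of_surjective (Ideal.Quotient.mkₐ K m) Ideal.Quotient.mk_surjective
  have : Module.Finite K (A ⧸ m) := finite_of_finite_type_of_isJacobsonRing K (A ⧸ m)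
  exact ⟨(AlgEquiv.ofBijective (Algebra.ofId K (A ⧸ m))
    IsAlgClosed.algebraMap_bijective_of_isIntegral).symm.toAlgHom.comp (Ideal.Quotient.mkₐ K m)⟩

namespace HasSubrep

variable {E T : Type*} {n D : E → ℕ} {s t : T → E}

/-- Subrepresentations descend from an extension field to an algebraically closed field: the
entries of the matrices `g` and `h` generate an algebra of finite type, which has a rational
point. -/
theorem of_field_extension [Finite E] {K k : Type*} [Field K] [IsAlgClosed K] [Field k]
    [Algebra K k] {X : ∀ τ, Matrix (Fin (n (t τ))) (Fin (n (s τ))) K}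
    (hX : HasSubrep D fun τ => (X τ).map (algebraMap K k)) : HasSubrep D X := by
  obtain ⟨g, h, hg, hX⟩ := hX
  let W : Set k := (Set.range fun c : Σ e, Fin (n e) × Fin (n e) => g c.1 c.2.1 c.2.2) ∪
    Set.range fun c : Σ e, Fin (n e) × Fin (n e) => h c.1 c.2.1 c.2.2
  let A := Algebra.adjoin K W
  have : Algebra.FiniteType K A := by
    rw [← Subalgebra.fg_iff_finiteType, Subalgebra.fg_def]
    exact ⟨W, (Set.finite_range _).union (Set.finite_range _), rfl⟩
  obtain ⟨φ⟩ := IsAlgClosed.nonempty_algHom_of_finiteType K A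
  have hA : HasSubrep D fun τ => (X τ).map (algebraMap K A) := by
    let g' : ∀ e, Matrix (Fin (n e)) (Fin (n e)) A := fun e => .of fun a b =>
      ⟨g e a b, Algebra.subset_adjoin (.inl ⟨⟨e, a, b⟩, rfl⟩)⟩
    let h' : ∀ e, Matrix (Fin (n e)) (Fin (n e)) A := fun e => .of fun a b =>
      ⟨h e a b, Algebra.subset_adjoin (.inr ⟨⟨e, a, b⟩, rfl⟩)⟩
    refine ⟨g', h', fun e => ?_, fun τ a b hb ha => ?_⟩
    · apply Matrix.map_injective (f := algebraMap A k) Subtype.val_injective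
      simp only
      rw [Matrix.map_mul, Matrix.map_one _ (map_zero _) (map_one _)]
      exact hg e
    · apply Subtype.val_injective
      have : ((h' (t τ) * (X τ).map (algebraMap K A) * g' (s τ)).map (algebraMap A k)) a b = 0 := by
        rw [Matrix.map_mul, Matrix.map_mul]
        exact hX τ a b hb ha
      exact this
  have := hA.map φ.toRingHom
  convert this using 2 with τ
  ext a b
  exact (φ.commutes _).symm

/-- A specialization: if `ev` is a rational point in the closure of an `F`-valued point `ψ` of an
algebra `A`, then subrepresentations specialize from `ψ` to `ev`. A valuation ring of `F` that
dominates the local ring at `ev` carries the subrepresentation to its residue field, which extends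
`K`. -/
theorem of_specialization [Finite E] {K A F : Type*} [Field K] [IsAlgClosed K] [CommRing A]
    [Algebra K A] [Field F] (ev : A →ₐ[K] K) (ψ : A →+* F) (hψ : ∀ f, ev f ≠ 0 → ψ f ≠ 0)
    {X : ∀ τ, Matrix (Fin (n (t τ))) (Fin (n (s τ))) A}
    (hX : HasSubrep D fun τ => (X τ).map ψ) : HasSubrep D fun τ => (X τ).map ev := by
  let m : Ideal A := RingHom.ker ev
  have hm : m.IsPrime := RingHom.ker_isPrime _
  have hψ' : ∀ f : m.primeCompl, IsUnit (ψ f) := fun f => isUnit_iff_ne_zero.2 (hψ f f.2)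
  let χ : Localization.AtPrime m →+* F := IsLocalization.lift (M := m.primeCompl) (g := ψ) hψ'
  obtain ⟨B, hB, hloc⟩ := IsLocalRing.exists_factor_valuationRing χ
  let ζ : A →+* B :=
    (χ.codRestrict B.toSubring hB).comp (algebraMap _ (Localization.AtPrime m))
  have hBX : HasSubrep D fun τ => (X τ).map ζ := by
    apply of_valuationSubring B
    convert hX using 2 with τ
    ext a b
    exact IsLocalization.lift_eq (M := m.primeCompl) (g := ψ) hψ' _
  let k := IsLocalRing.ResidueField B
  let η : A →+* k := (IsLocalRing.residue B).comp ζ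
  let _ : Algebra K k := (η.comp (algebraMap K A)).toAlgebra
  have hη : ∀ f, η f = algebraMap K k (ev f) := by
    intro f
    have hf : f - algebraMap K A (ev f) ∈ m := by simp [m]
    have : η (f - algebraMap K A (ev f)) = 0 := by
      change IsLocalRing.residue B _ = 0
      rw [IsLocalRing.residue_eq_zero_iff, IsLocalRing.mem_maximalIdeal, mem_nonunits_iff]
      intro hu
      have := (IsLocalization.AtPrime.isUnit_to_map_iff (Localization.AtPrime m) m _).1
        (hloc.map_nonunit _ hu)
      exact this hf
    rw [map_sub, sub_eq_zero] at this
    exact this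
  apply of_field_extension (k := k)
  have e : (fun τ => ((X τ).map ev).map (algebraMap K k)) =
      fun τ => ((X τ).map ζ).map (IsLocalRing.residue B) := by
    funext τ
    ext a b
    exact (hη _).symm
  rw [e]
  exact hBX.map (IsLocalRing.residue B)

/-- The quiver Grassmannian of a family of representations that depends polynomially on
parameters is nonempty on a Zariski closed set: if `x` satisfies all polynomial equations that
hold where the Grassmannian is nonempty, then it is nonempty at `x`. -/
theorem eval_of_forall_eval_eq_zero [Finite E] {K σ : Type*} [Field K] [IsAlgClosed K]
    (X : ∀ τ, Matrix (Fin (n (t τ))) (Fin (n (s τ))) (MvPolynomial σ K)) (x : σ → K)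
    (hx : ∀ f : MvPolynomial σ K,
      (∀ z, (HasSubrep D fun τ => (X τ).map (MvPolynomial.eval z)) → MvPolynomial.eval z f = 0) →
        MvPolynomial.eval x f = 0) :
    HasSubrep D fun τ => (X τ).map (MvPolynomial.eval x) := by
  let Z := {z : σ → K // HasSubrep D fun τ => (X τ).map (MvPolynomial.eval z)}
  let ρ : MvPolynomial σ K →+* (Z → K) := RingHom.pi fun z => MvPolynomial.eval z.1
  let m : Ideal (MvPolynomial σ K) := RingHom.ker (MvPolynomial.eval x)
  have hm : m.IsPrime := RingHom.ker_isPrime _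
  -- The functions on the locus `Z` modulo `q` form a domain, and the coordinates in its fraction
  -- field form a point that specializes to `x`, because `q` contains no `f` with `f x ≠ 0`.
  obtain ⟨q, hq, -, hdisj⟩ := Ideal.exists_le_prime_disjoint (⊥ : Ideal (Z → K))
    (m.primeCompl.map ρ) (by
      rw [Set.disjoint_left]
      rintro _ hf ⟨f, hfm, rfl⟩
      exact hfm (hx f fun z hz => congrFun (show ρ f = 0 from hf) ⟨z, hz⟩))
  let ψ : (Z → K) →+* FractionRing ((Z → K) ⧸ q) := (algebraMap _ _).comp (Ideal.Quotient.mk q)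
  refine of_specialization (MvPolynomial.aeval x) (ψ.comp ρ) (fun f hf h0 => ?_) ?_
  · have h1 : Ideal.Quotient.mk q (ρ f) = 0 :=
      IsFractionRing.injective ((Z → K) ⧸ q) (FractionRing ((Z → K) ⧸ q))
        (h0.trans (map_zero _).symm)
    exact Set.disjoint_left.1 hdisj (Ideal.Quotient.eq_zero_iff_mem.1 h1) ⟨f, hf, rfl⟩
  · have := (HasSubrep.pi (D := D) (X := fun τ => (X τ).map ρ) fun z => z.2).map ψ
    simpa [Matrix.map_map] using this

end HasSubrep

/-! ### Subrepresentations over a field -/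

/-- The vectors in `K ^ n` with at most the first `r` entries nonzero. -/
def initialSubspace (K : Type*) [Field K] (n r : ℕ) : Submodule K (Fin n → K) where
  carrier := {v | ∀ a : Fin n, r ≤ (a : ℕ) → v a = 0}
  add_mem' hv hw a ha := by simp [hv a ha, hw a ha]
  zero_mem' _ _ := rfl
  smul_mem' c v hv a ha := by simp [hv a ha]

theorem finrank_initialSubspace (K : Type*) [Field K] {n r : ℕ} (h : r ≤ n) :
    Module.finrank K (initialSubspace K n r) = r := by
  have hbij : Function.Bijective
      ((LinearMap.funLeft K K (Fin.castLE h)).domRestrict (initialSubspace K n r)) := by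
    refine ⟨?_, fun w => ?_⟩
    · rw [← LinearMap.ker_eq_bot, LinearMap.ker_eq_bot']
      rintro ⟨v, hv⟩ h0
      ext a
      by_cases ha : (a : ℕ) < r
      · exact congrFun h0 ⟨a, ha⟩
      · exact hv a (not_lt.1 ha)
    · refine ⟨⟨fun a => if ha : (a : ℕ) < r then w ⟨a, ha⟩ else 0, fun a ha => ?_⟩, ?_⟩
      · simp [ha.not_gt]
      · ext a
        simp [LinearMap.funLeft]
  rw [(LinearEquiv.ofBijective _ hbij).finrank_eq, Module.finrank_fin_fun]

/-- Subspaces of the same dimension are conjugate under linear automorphisms. -/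
theorem Submodule.exists_linearEquiv_mem_iff {K W : Type*} [Field K] [AddCommGroup W] [Module K W]
    [FiniteDimensional K W] {U U' : Submodule K W}
    (h : Module.finrank K U = Module.finrank K U') : ∃ e : W ≃ₗ[K] W, ∀ v, e v ∈ U' ↔ v ∈ U := by
  obtain ⟨C, hC⟩ := U.exists_isCompl
  obtain ⟨C', hC'⟩ := U'.exists_isCompl
  have h' : Module.finrank K C = Module.finrank K C' := by
    have h1 := Submodule.finrank_add_eq_of_isCompl hC
    have h2 := Submodule.finrank_add_eq_of_isCompl hC'
    omega
  let eU := LinearEquiv.ofFinrankEq U U' h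
  let eC := LinearEquiv.ofFinrankEq C C' h'
  refine ⟨(U.prodEquivOfIsCompl C hC).symm ≪≫ₗ eU.prodCongr eC ≪≫ₗ U'.prodEquivOfIsCompl C' hC',
    fun v => ?_⟩
  rw [← Submodule.prodEquivOfIsCompl_symm_apply_snd_eq_zero U' C' hC',
    ← Submodule.prodEquivOfIsCompl_symm_apply_snd_eq_zero U C hC]
  simp

theorem hasSubrep_iff_exists_submodule {E T : Type*} {n D : E → ℕ} (hD : ∀ e, D e ≤ n e)
    {s t : T → E} {K : Type*} [Field K] {X : ∀ τ, Matrix (Fin (n (t τ))) (Fin (n (s τ))) K} :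
    HasSubrep D X ↔ ∃ U : ∀ e, Submodule K (Fin (n e) → K),
      (∀ e, Module.finrank K (U e) = D e) ∧
        ∀ τ, ∀ v ∈ U (s τ), (X τ).mulVec v ∈ U (t τ) := by
  constructor
  · rintro ⟨g, h, hg, hX⟩
    have hg' : ∀ e, g e * h e = 1 := fun e => mul_eq_one_comm.1 (hg e)
    refine ⟨fun e => (initialSubspace K (n e) (D e)).comap (h e).mulVecLin, fun e => ?_,
      fun τ v hv a ha => ?_⟩
    · let φ : (Fin (n e) → K) ≃ₗ[K] (Fin (n e) → K) := Matrix.toLin'OfInv (hg e) (hg' e)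
      have hφ : (initialSubspace K (n e) (D e)).comap (h e).mulVecLin =
          (initialSubspace K (n e) (D e)).map (φ : (Fin (n e) → K) →ₗ[K] (Fin (n e) → K)) := by
        rw [Submodule.map_equiv_eq_comap_symm]
        rfl
      have hfin := finrank_initialSubspace K (hD e)
      rw [← LinearEquiv.finrank_map_eq φ, ← hφ] at hfin
      exact hfin
    · have e1 : (h (t τ)).mulVec ((X τ).mulVec v) =
          (h (t τ) * X τ * g (s τ)).mulVec ((h (s τ)).mulVec v) := by
        rw [Matrix.mulVec_mulVec, Matrix.mulVec_mulVec, Matrix.mul_assoc _ (g _), hg',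
          Matrix.mul_one]
      rw [Matrix.mulVecLin_apply, e1, Matrix.mulVec, dotProduct]
      refine Finset.sum_eq_zero fun b _ => ?_
      by_cases hb : (b : ℕ) < D (s τ)
      · rw [hX τ a b hb ha, zero_mul]
      · rw [show (h (s τ)).mulVec v b = 0 from hv b (not_lt.1 hb), mul_zero]
  · rintro ⟨U, hU, hX⟩
    have H : ∀ e, ∃ φ : (Fin (n e) → K) ≃ₗ[K] (Fin (n e) → K),
        ∀ v, φ v ∈ initialSubspace K (n e) (D e) ↔ v ∈ U e := fun e =>
      Submodule.exists_linearEquiv_mem_iff ((hU e).trans (finrank_initialSubspace K (hD e)).symm)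
    choose φ hφ using H
    refine ⟨fun e => LinearMap.toMatrix' (φ e).symm.toLinearMap,
      fun e => LinearMap.toMatrix' (φ e).toLinearMap, fun e => ?_, fun τ a b hb ha => ?_⟩
    · rw [← LinearMap.toMatrix'_comp]
      simp
    · have hb' : (φ (s τ)).symm (Pi.single b 1) ∈ U (s τ) := by
        rw [← hφ, LinearEquiv.apply_symm_apply]
        intro c hc
        exact Pi.single_eq_of_ne (by rintro rfl; omega) _
      have := (hφ _ _).2 (hX τ _ hb') a ha
      rw [← LinearEquiv.coe_coe, ← LinearEquiv.coe_coe, ← LinearMap.toMatrix'_mulVec,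
        ← LinearMap.toMatrix'_mulVec (φ (s τ)).symm.toLinearMap, Matrix.mulVec_mulVec,
        Matrix.mulVec_mulVec, Matrix.mulVec_single_one] at this
      exact this

/-! ### Modules over an admissible quotient of a path algebra -/

theorem QuiverPath.finite_setOf_length_eq {V : Type*} [Fintype V] [Quiver V]
    [∀ i j : V, Finite (i ⟶ j)] (n : ℕ) :
    {p : QuiverPath V | p.2.2.length = n}.Finite := by
  induction n with
  | zero =>
    refine (Set.finite_range fun i : V => (⟨i, i, .nil⟩ : QuiverPath V)).subset ?_
    rintro ⟨i, j, p⟩ hp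
    cases p with
    | nil => exact ⟨i, rfl⟩
    | cons p a => simp at hp
  | succ n ih =>
    refine (ih.biUnion fun q _ => Set.finite_iUnion fun c =>
      Set.finite_range fun a : q.2.1 ⟶ c => (⟨q.1, c, q.2.2.cons a⟩ : QuiverPath V)).subset ?_
    rintro ⟨i, j, p⟩ hp
    cases p with
    | nil => simp at hp
    | @cons b _ p a =>
      exact Set.mem_biUnion (x := ⟨i, b, p⟩) (by simpa using hp) (Set.mem_iUnion.2 ⟨j, a, rfl⟩)

section

variable {K : Type*} [Field K] {V : Type*} [Fintype V] [DecidableEq V] [Quiver V]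

namespace PathAlgebra

variable (K V) in
/-- The span of the paths of length at least `n`: the `n`-th power of the arrow ideal. -/
noncomputable def arrowPower (n : ℕ) : Submodule K (PathAlgebra K V) :=
  Submodule.span K (ofPath K '' {p | n ≤ p.2.2.length})

theorem ofPath_mem_arrowPower {n : ℕ} {p : QuiverPath V} (h : n ≤ p.2.2.length) :
    ofPath K p ∈ arrowPower K V n :=
  Submodule.subset_span ⟨p, h, rfl⟩

theorem mem_arrowPower_zero (f : PathAlgebra K V) : f ∈ arrowPower K V 0 := by
  induction f using PathAlgebra.induction with
  | h0 => exact zero_mem _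
  | hadd f g hf hg => exact add_mem hf hg
  | hsmul c f hf => exact Submodule.smul_mem _ c hf
  | hpath p => exact ofPath_mem_arrowPower (Nat.zero_le _)

theorem mul_mem_arrowPower {a b : ℕ} {f g : PathAlgebra K V} (hf : f ∈ arrowPower K V a)
    (hg : g ∈ arrowPower K V b) : f * g ∈ arrowPower K V (a + b) := by
  refine (Submodule.mul_le (M := arrowPower K V a) (N := arrowPower K V b)).1 ?_ f hf g hg
  rw [arrowPower, arrowPower, Submodule.span_mul_span, Submodule.span_le]
  rintro _ ⟨_, ⟨⟨i, j, p⟩, hp, rfl⟩, _, ⟨⟨k, l, q⟩, hq, rfl⟩, rfl⟩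
  simp only [ofPath_mul_ofPath]
  by_cases h : l = i
  · subst h
    rw [mulPath_comp]
    refine ofPath_mem_arrowPower ?_
    simp only [Set.mem_ofPred_eq, Quiver.Path.length_comp] at hp hq ⊢
    omega
  · rw [mulPath_of_ne K h]
    exact zero_mem _

theorem pow_mem_arrowPower {f : PathAlgebra K V} (hf : f ∈ arrowPower K V 1) (n : ℕ) :
    f ^ n ∈ arrowPower K V n := by
  induction n with
  | zero => exact mem_arrowPower_zero _
  | succ n ih => rw [pow_succ]; exact mul_mem_arrowPower ih hf

end PathAlgebra

open PathAlgebra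

variable {I : Ideal (PathAlgebra K V)} [I.IsTwoSided]

/-- Arrows lie in the Jacobson radical, since left multiples of them are nilpotent. -/
theorem mk_ofPath_mem_jacobson (hI : IsAdmissibleIdeal I) {p : QuiverPath V}
    (hp : 1 ≤ p.2.2.length) :
    Ideal.Quotient.mk I (ofPath K p) ∈ Ring.jacobson (PathAlgebra K V ⧸ I) := by
  obtain ⟨m, hm⟩ := hI.exists_long_paths_mem
  have hnil : ∀ f ∈ arrowPower K V 1, IsNilpotent (Ideal.Quotient.mk I f) := by
    intro f hf
    refine ⟨m, ?_⟩
    rw [← map_pow, Ideal.Quotient.eq_zero_iff_mem]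
    have : arrowPower K V m ≤ I.restrictScalars K := by
      rw [arrowPower, Submodule.span_le]
      rintro _ ⟨p, hp, rfl⟩
      exact hm p hp
    exact this (pow_mem_arrowPower hf m)
  rw [Ring.jacobson_eq_sInf_isMaximal, Submodule.mem_sInf]
  intro M hM
  by_contra hpM
  obtain ⟨r, y, hy, hr⟩ := hM.exists_inv hpM
  obtain ⟨r, rfl⟩ := Ideal.Quotient.mk_surjective r
  have hmem : r * ofPath K p ∈ arrowPower K V 1 := by
    simpa using mul_mem_arrowPower (mem_arrowPower_zero r) (ofPath_mem_arrowPower hp)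
  have hu : IsUnit y := by
    rw [← add_sub_cancel_left (Ideal.Quotient.mk I r * Ideal.Quotient.mk I (ofPath K p)) y, hr,
      ← map_mul]
    exact (hnil _ hmem).isUnit_one_sub
  exact hM.ne_top (Ideal.eq_top_of_isUnit_mem _ hy hu)

theorem mk_ofPath_smul_eq_zero (hI : IsAdmissibleIdeal I) {p : QuiverPath V}
    (hp : 1 ≤ p.2.2.length) {M : Type*} [AddCommGroup M] [Module (PathAlgebra K V ⧸ I) M]
    [IsSemisimpleModule (PathAlgebra K V ⧸ I) M] (v : M) :
    Ideal.Quotient.mk I (ofPath K p) • v = 0 :=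
  Module.mem_annihilator.1
    (IsSemisimpleModule.jacobson_le_annihilator _ M (mk_ofPath_mem_jacobson hI hp)) v

theorem IsAdmissibleIdeal.finite_quotient [∀ i j : V, Finite (i ⟶ j)] (hI : IsAdmissibleIdeal I) :
    Module.Finite K (PathAlgebra K V ⧸ I) := by
  obtain ⟨m, hm⟩ := hI.exists_long_paths_mem
  have hfin : {p : QuiverPath V | p.2.2.length < m}.Finite := by
    refine ((Set.finite_Iio m).biUnion fun n _ => QuiverPath.finite_setOf_length_eq n).subset ?_
    intro p hp
    exact Set.mem_biUnion (x := p.2.2.length) hp rfl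
  refine Module.finite_def.2 (Submodule.fg_def.2
    ⟨_, hfin.image fun p => Ideal.Quotient.mk I (ofPath K p), eq_top_iff.2 ?_⟩)
  rintro y -
  obtain ⟨f, rfl⟩ := Ideal.Quotient.mk_surjective y
  induction f using PathAlgebra.induction with
  | h0 => simp
  | hadd f g hf hg => rw [map_add]; exact add_mem hf hg
  | hsmul c f hf => exact Submodule.smul_mem _ c hf
  | hpath p =>
    by_cases hp : p.2.2.length < m
    · exact Submodule.subset_span ⟨p, hp, rfl⟩
    · rw [Ideal.Quotient.eq_zero_iff_mem.2 (hm p (not_lt.1 hp))]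
      exact zero_mem _

/-- The set whose infimum defines `loewyIndex` is not empty, so that the infimum is attained. -/
theorem jacobson_pow_loewyIndex_succ [∀ i j : V, Finite (i ⟶ j)] (hI : IsAdmissibleIdeal I) :
    Ring.jacobson (PathAlgebra K V ⧸ I) ^ (loewyIndex I + 1) = ⊥ := by
  have := hI.finite_quotient
  have : IsArtinianRing (PathAlgebra K V ⧸ I) := IsArtinianRing.of_finite K _
  obtain ⟨n, hn⟩ := IsSemiprimaryRing.isNilpotent (R := PathAlgebra K V ⧸ I)
  exact Nat.sInf_mem (s := {n | Ring.jacobson (PathAlgebra K V ⧸ I) ^ (n + 1) = ⊥})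
    ⟨n, by rw [Set.mem_ofPred_eq, Submodule.pow_succ, hn]; simp⟩

/-- The chain of the `J ^ l M` ends in `0`, since `J ^ (L + 1) = 0`. -/
theorem SemisimpleSequence.IsRadicalLayering.governsFiltration [∀ i j : V, Finite (i ⟶ j)]
    (hI : IsAdmissibleIdeal I) {S : SemisimpleSequence I} {M : Type*} [AddCommGroup M]
    [Module (PathAlgebra K V ⧸ I) M] (h : S.IsRadicalLayering M) : S.GovernsFiltration M := by
  refine ⟨fun l => radicalPower I M l, ?_, ?_, fun l => ⟨?_, h l⟩⟩
  · simp [radicalPower, Submodule.pow_zero, Ideal.one_eq_top]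
  · simp [radicalPower, jacobson_pow_loewyIndex_succ hI]
  · simp only [radicalPower, Fin.val_succ, Fin.val_castSucc]
    exact Submodule.smul_mono_left (Ideal.pow_le_pow_right (Nat.le_succ _))

section vertexSpace

variable {N N' : Type*} [AddCommGroup N] [Module K N] [Module (PathAlgebra K V ⧸ I) N]
  [IsScalarTower K (PathAlgebra K V ⧸ I) N] [AddCommGroup N'] [Module K N']
  [Module (PathAlgebra K V ⧸ I) N'] [IsScalarTower K (PathAlgebra K V ⧸ I) N']

variable (I) in
/-- The primitive idempotent `e_i` of `KQ / I`. -/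
noncomputable def vertexIdempotent (i : V) : PathAlgebra K V ⧸ I :=
  Ideal.Quotient.mk I (ofPath K ⟨i, i, .nil⟩)

theorem vertexIdempotent_mul_self (i : V) :
    vertexIdempotent I i * vertexIdempotent I i = vertexIdempotent I i := by
  rw [vertexIdempotent, ← map_mul, ofPath_mul_ofPath, mulPath_comp, Quiver.Path.comp_nil]

theorem vertexIdempotent_mul_of_ne {i j : V} (h : i ≠ j) :
    vertexIdempotent I i * vertexIdempotent I j = 0 := by
  rw [vertexIdempotent, vertexIdempotent, ← map_mul, ofPath_mul_ofPath, mulPath_of_ne K h.symm,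
    map_zero]

variable (I) in
theorem sum_vertexIdempotent : ∑ i, vertexIdempotent I i = 1 := by
  simp only [vertexIdempotent]
  rw [← map_sum, ← one_def, map_one]

theorem vertexIdempotent_smul_mem (i : V) (v : N) :
    vertexIdempotent I i • v ∈ vertexSpace I N i := ⟨v, rfl⟩

theorem vertexIdempotent_smul_of_mem {i : V} {v : N} (hv : v ∈ vertexSpace I N i) :
    vertexIdempotent I i • v = v := by
  obtain ⟨w, rfl⟩ := hv
  change vertexIdempotent I i • vertexIdempotent I i • w = vertexIdempotent I i • w
  rw [smul_smul, vertexIdempotent_mul_self]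

theorem vertexIdempotent_smul_of_mem_of_ne {i j : V} {v : N} (hv : v ∈ vertexSpace I N i)
    (h : j ≠ i) : vertexIdempotent I j • v = 0 := by
  rw [← vertexIdempotent_smul_of_mem hv, smul_smul, vertexIdempotent_mul_of_ne h, zero_smul]

/-- A map between modules that are annihilated by all arrows amounts to a linear map at each
vertex. -/
theorem exists_linearMap_of_vertexSpace
    (hN : ∀ p : QuiverPath V, 1 ≤ p.2.2.length →
      ∀ v : N, Ideal.Quotient.mk I (ofPath K p) • v = 0)
    (hN' : ∀ p : QuiverPath V, 1 ≤ p.2.2.length →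
      ∀ v : N', Ideal.Quotient.mk I (ofPath K p) • v = 0)
    (φ : ∀ i, vertexSpace I N i →ₗ[K] vertexSpace I N' i) :
    ∃ f : N →ₗ[PathAlgebra K V ⧸ I] N', ∀ i, ∀ v : vertexSpace I N i, f v = φ i v := by
  let f : N →ₗ[K] N' := ∑ i, (vertexSpace I N' i).subtype ∘ₗ φ i ∘ₗ
    (Algebra.lsmul K K N (vertexIdempotent I i)).codRestrict _ (vertexIdempotent_smul_mem i)
  have hf : ∀ i, ∀ v : vertexSpace I N i, f v = φ i v := by
    rintro i ⟨v, hv⟩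
    simp only [f, LinearMap.sum_apply]
    rw [Finset.sum_eq_single i]
    · have : (Algebra.lsmul K K N (vertexIdempotent I i)).codRestrict _
          (vertexIdempotent_smul_mem i) v = ⟨v, hv⟩ :=
        Subtype.ext (vertexIdempotent_smul_of_mem hv)
      exact congrArg (fun w => (φ i w : N')) this
    · intro j _ hj
      have : (Algebra.lsmul K K N (vertexIdempotent I j)).codRestrict _
          (vertexIdempotent_smul_mem j) v = 0 :=
        Subtype.ext (vertexIdempotent_smul_of_mem_of_ne hv hj)
      rw [LinearMap.comp_apply, LinearMap.comp_apply, this, map_zero, map_zero]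
    · simp
  have hdecomp : ∀ v : N, v = ∑ i, vertexIdempotent I i • v := fun v => by
    rw [← Finset.sum_smul, sum_vertexIdempotent, one_smul]
  have hfe : ∀ (i : V) (v : N), f (vertexIdempotent I i • v) = vertexIdempotent I i • f v := by
    intro i v
    conv_rhs => rw [hdecomp v, map_sum, Finset.smul_sum]
    rw [Finset.sum_eq_single i]
    · have := hf i ⟨_, vertexIdempotent_smul_mem i v⟩
      rw [this, vertexIdempotent_smul_of_mem (φ i _).2]
    · intro j _ hj
      have := hf j ⟨_, vertexIdempotent_smul_mem j v⟩
      rw [this, vertexIdempotent_smul_of_mem_of_ne (φ j _).2 hj.symm]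
    · simp
  refine ⟨{ toFun := f, map_add' := map_add f, map_smul' := fun r v => ?_ }, hf⟩
  obtain ⟨r, rfl⟩ := Ideal.Quotient.mk_surjective r
  rw [RingHom.id_apply]
  induction r using PathAlgebra.induction with
  | h0 => simp
  | hadd r r' h h' => simp only [map_add, add_smul, h, h']
  | hsmul c r h =>
    have : Ideal.Quotient.mk I (c • r) = c • Ideal.Quotient.mk I r := rfl
    rw [this, smul_assoc, smul_assoc, map_smul, h]
  | hpath p =>
    obtain ⟨i, j, p⟩ := p
    cases p with
    | nil => exact hfe i v
    | cons p a => rw [hN _ (by simp), hN' _ (by simp), map_zero]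

/-- Modules annihilated by all arrows are determined by their dimension vectors. -/
theorem nonempty_linearEquiv_of_finrank_vertexSpace_eq [FiniteDimensional K N]
    [FiniteDimensional K N']
    (hN : ∀ p : QuiverPath V, 1 ≤ p.2.2.length →
      ∀ v : N, Ideal.Quotient.mk I (ofPath K p) • v = 0)
    (hN' : ∀ p : QuiverPath V, 1 ≤ p.2.2.length →
      ∀ v : N', Ideal.Quotient.mk I (ofPath K p) • v = 0)
    (h : ∀ i, Module.finrank K (vertexSpace I N i) = Module.finrank K (vertexSpace I N' i)) :
    Nonempty (N ≃ₗ[PathAlgebra K V ⧸ I] N') := by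
  let φ := fun i => LinearEquiv.ofFinrankEq _ _ (h i)
  obtain ⟨f, hf⟩ := exists_linearMap_of_vertexSpace hN hN' fun i => (φ i).toLinearMap
  obtain ⟨g, hg⟩ := exists_linearMap_of_vertexSpace hN' hN fun i => (φ i).symm.toLinearMap
  refine ⟨LinearEquiv.ofLinearMap f g (LinearMap.ext fun v => ?_) (LinearMap.ext fun v => ?_)⟩
  · rw [← one_smul (PathAlgebra K V ⧸ I) v, ← sum_vertexIdempotent I, Finset.sum_smul, map_sum,
      map_sum]
    refine Finset.sum_congr rfl fun i _ => ?_
    have := hg i ⟨_, vertexIdempotent_smul_mem i v⟩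
    rw [LinearMap.comp_apply, this, hf]
    simp
  · rw [← one_smul (PathAlgebra K V ⧸ I) v, ← sum_vertexIdempotent I, Finset.sum_smul, map_sum,
      map_sum]
    refine Finset.sum_congr rfl fun i _ => ?_
    have := hf i ⟨_, vertexIdempotent_smul_mem i v⟩
    rw [LinearMap.comp_apply, this, hg]
    simp

theorem finrank_vertexSpace_eq_of_linearEquiv (e : N ≃ₗ[PathAlgebra K V ⧸ I] N') (i : V) :
    Module.finrank K (vertexSpace I N i) = Module.finrank K (vertexSpace I N' i) := by
  have h : vertexSpace I N' i = (vertexSpace I N i).map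
      ((e.restrictScalars K : N ≃ₗ[K] N') : N →ₗ[K] N') := by
    ext w
    constructor
    · rintro ⟨w, rfl⟩
      exact ⟨_, vertexIdempotent_smul_mem i (e.symm w), by
        simp only [LinearEquiv.coe_coe, LinearEquiv.restrictScalars_apply, map_smul,
          LinearEquiv.apply_symm_apply]
        rfl⟩
    · rintro ⟨_, ⟨v, rfl⟩, rfl⟩
      exact ⟨e v, (map_smul e (vertexIdempotent I i) v).symm⟩
  rw [h, LinearEquiv.finrank_map_eq]

end vertexSpace

end

/-! ### Filtrations of the modules `M_x` as subrepresentations -/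

section

open PathAlgebra

variable {K : Type*} [Field K] {V : Type*} [Fintype V] [DecidableEq V] [Quiver V]
  {I : Ideal (PathAlgebra K V)} {d : V → ℕ}

namespace RepModule

variable (x : RepVariety I d)

instance : FiniteDimensional K (RepModule x) :=
  inferInstanceAs (FiniteDimensional K (∀ i : V, Fin (d i) → K))

/-- The inclusion of the component at the vertex `i`. -/
def single (i : V) : (Fin (d i) → K) →ₗ[K] RepModule x :=
  LinearMap.single K (fun i : V => Fin (d i) → K) i

theorem single_apply_self (i : V) (v : Fin (d i) → K) : single x i v i = v :=
  Pi.single_eq_same (M := fun i : V => Fin (d i) → K) i v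

variable [I.IsTwoSided]

instance : IsScalarTower K (PathAlgebra K V ⧸ I) (RepModule x) where
  smul_assoc c r v := by
    obtain ⟨r, rfl⟩ := Ideal.Quotient.mk_surjective r
    have h1 : c • Ideal.Quotient.mk I r = Ideal.Quotient.mk I (c • r) := rfl
    rw [h1, mk_smul, mk_smul, map_smul]
    rfl

instance (F : Submodule (PathAlgebra K V ⧸ I) (RepModule x)) : FiniteDimensional K F :=
  inferInstanceAs (FiniteDimensional K (F.restrictScalars K))

theorem mk_ofPath_smul {i j : V} (p : Quiver.Path i j) (v : RepModule x) :
    Ideal.Quotient.mk I (ofPath K ⟨i, j, p⟩) • v = single x j ((x.1.pathMatrix p).mulVec (v i)) := by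
  rw [mk_smul, ArrowTuple.repHom_ofPath]
  rfl

theorem vertexIdempotent_smul (i : V) (v : RepModule x) :
    vertexIdempotent I i • v = single x i (v i) := by
  rw [vertexIdempotent, mk_ofPath_smul]
  simp [ArrowTuple.pathMatrix]

/-- The component at the vertex `i` of a submodule of `M_x`. -/
noncomputable def component (F : Submodule (PathAlgebra K V ⧸ I) (RepModule x)) (i : V) :
    Submodule K (Fin (d i) → K) :=
  (F.restrictScalars K).comap (single x i)

variable {x}

theorem finrank_vertexSpace_add_finrank_component
    {F F' : Submodule (PathAlgebra K V ⧸ I) (RepModule x)} (h : F' ≤ F) (i : V) :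
    Module.finrank K (vertexSpace I (F ⧸ F'.submoduleOf F) i) +
      Module.finrank K (component x F' i) = Module.finrank K (component x F i) := by
  let π : component x F i →ₗ[K] F ⧸ F'.submoduleOf F :=
    ((F'.submoduleOf F).mkQ.restrictScalars K) ∘ₗ
      ((single x i).restrict (p := component x F i) (q := F.restrictScalars K) fun v hv => hv)
  have hπ : ∀ v (hv : v ∈ component x F i),
      π ⟨v, hv⟩ = (F'.submoduleOf F).mkQ ⟨single x i v, hv⟩ := fun v hv => rfl
  have hker : Module.finrank K (LinearMap.ker π) = Module.finrank K (component x F' i) := by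
    have hle : component x F' i ≤ component x F i := Submodule.comap_mono h
    have : LinearMap.ker π = (component x F' i).submoduleOf (component x F i) := by
      ext ⟨v, hv⟩
      rw [LinearMap.mem_ker, hπ, Submodule.mkQ_apply, Submodule.Quotient.mk_eq_zero]
      rfl
    rw [this]
    exact (Submodule.submoduleOfEquivOfLe hle).finrank_eq
  have hrange : LinearMap.range π = vertexSpace I (F ⧸ F'.submoduleOf F) i := by
    ext w
    constructor
    · rintro ⟨⟨v, hv⟩, rfl⟩
      refine ⟨π ⟨v, hv⟩, ?_⟩
      change vertexIdempotent I i • π ⟨v, hv⟩ = π ⟨v, hv⟩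
      rw [hπ, ← map_smul]
      congr 1
      ext1
      change vertexIdempotent I i • single x i v = single x i v
      rw [vertexIdempotent_smul, single_apply_self]
    · rintro ⟨w, rfl⟩
      obtain ⟨⟨v, hv⟩, rfl⟩ := Submodule.mkQ_surjective _ w
      have hmem : single x i (v i) ∈ F := by
        rw [← vertexIdempotent_smul]
        exact F.smul_mem _ hv
      refine ⟨⟨v i, hmem⟩, ?_⟩
      change _ = vertexIdempotent I i • (F'.submoduleOf F).mkQ ⟨v, hv⟩
      refine (hπ (v i) hmem).trans ?_
      rw [← map_smul]
      congr 1
      ext1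
      exact (vertexIdempotent_smul x i v).symm
  rw [← hker, ← hrange, LinearMap.finrank_range_add_finrank_ker]

end RepModule

/-- The arrows of the quiver `Q × {0, …, m}` whose representations encode chains of length `m`:
an arrow `(i, l) → (j, l + 1)` for each arrow `i → j` of `Q`, and an arrow `(i, l + 1) → (i, l)`
for each vertex `i` of `Q`. -/
inductive LayerArrow (V : Type*) [Quiver V] (m : ℕ)
  | arrow {i j : V} (a : i ⟶ j) (l : Fin m)
  | inclusion (i : V) (l : Fin m)

namespace LayerArrow

variable {V' : Type*} [Quiver V'] {m : ℕ}

/-- The vertex at which an arrow starts. -/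
def source : LayerArrow V' m → V' × Fin (m + 1)
  | arrow (i := i) _ l => (i, l.castSucc)
  | inclusion i l => (i, l.succ)

/-- The vertex at which an arrow ends. -/
def target : LayerArrow V' m → V' × Fin (m + 1)
  | arrow (j := j) _ l => (j, l.succ)
  | inclusion i l => (i, l.castSucc)

/-- The representation of `Q × {0, …, m}` with `m + 1` copies of the spaces of a representation
`x` of `Q`. The arrows of `Q` act by `x`, and the other arrows act as the identity. A
subrepresentation is a chain `U_0 ⊇ ⋯ ⊇ U_m` of graded subspaces such that `x` maps `U_l` to
`U_{l + 1}`. -/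
def rep {d : V' → ℕ} {R : Type*} [CommRing R]
    (x : ∀ ⦃i j : V'⦄, (i ⟶ j) → Matrix (Fin (d j)) (Fin (d i)) R) :
    ∀ τ : LayerArrow V' m, Matrix (Fin (d τ.target.1)) (Fin (d τ.source.1)) R
  | arrow a _ => x a
  | inclusion i _ => (1 : Matrix (Fin (d i)) (Fin (d i)) R)

end LayerArrow

namespace SemisimpleSequence

variable [I.IsTwoSided]

/-- The dimension at the vertex `i` of the term `M_l` of a filtration that is governed by `𝕊`. -/
noncomputable def stepDim (S : SemisimpleSequence I) (e : V × Fin (loewyIndex I + 1 + 1)) : ℕ :=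
  ∑ l ∈ Finset.univ.filter fun l : Fin (loewyIndex I + 1) => e.2 ≤ l.castSucc,
    Module.finrank K (vertexSpace I (S.obj l) e.1)

variable {S : SemisimpleSequence I}

theorem stepDim_zero (i : V) : S.stepDim (i, 0) = S.dimVector i := by
  simp [stepDim, dimVector]

theorem stepDim_last (i : V) : S.stepDim (i, Fin.last _) = 0 := by
  rw [stepDim, Finset.filter_false_of_mem, Finset.sum_empty]
  intro l _
  exact not_le.2 (Fin.castSucc_lt_last l)

theorem stepDim_castSucc (i : V) (l : Fin (loewyIndex I + 1)) :
    S.stepDim (i, l.castSucc) =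
      Module.finrank K (vertexSpace I (S.obj l) i) + S.stepDim (i, l.succ) := by
  have : (Finset.univ.filter fun k : Fin (loewyIndex I + 1) => l.castSucc ≤ k.castSucc) =
      insert l (Finset.univ.filter fun k : Fin (loewyIndex I + 1) => l.succ ≤ k.castSucc) := by
    ext k
    simp only [Finset.mem_filter, Finset.mem_univ, true_and, Finset.mem_insert, Fin.le_def,
      Fin.val_castSucc, Fin.val_succ, Fin.ext_iff]
    omega
  rw [stepDim, stepDim, this, Finset.sum_insert]
  simp [Fin.le_def]

theorem stepDim_le_dimVector (e : V × Fin (loewyIndex I + 1 + 1)) :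
    S.stepDim e ≤ S.dimVector e.1 := by
  rw [stepDim, dimVector]
  exact Finset.sum_le_sum_of_subset (Finset.filter_subset _ _)

theorem hasSubrep_of_mem_filt (hI : IsAdmissibleIdeal I) (hS : S.dimVector = d)
    {x : RepVariety I d} (hx : x ∈ S.filt d) :
    HasSubrep (n := fun e => d e.1) S.stepDim (LayerArrow.rep x.1) := by
  rw [hasSubrep_iff_exists_submodule fun e => hS ▸ S.stepDim_le_dimVector e]
  obtain ⟨F, h0, hlast, hF⟩ := hx
  refine ⟨fun e => RepModule.component x (F e.2) e.1, ?_, ?_⟩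
  · rintro ⟨i, l⟩
    simp only
    induction l using Fin.reverseInduction with
    | last =>
      rw [stepDim_last, Submodule.finrank_eq_zero, Submodule.eq_bot_iff]
      intro v hv
      have hv0 : RepModule.single x i v ∈ F (Fin.last _) := hv
      rw [hlast, Submodule.mem_bot] at hv0
      rw [← RepModule.single_apply_self x i v, hv0]
      rfl
    | cast l ih =>
      rw [← RepModule.finrank_vertexSpace_add_finrank_component (hF l).1, ih, stepDim_castSucc]
      obtain ⟨e⟩ := (hF l).2
      rw [finrank_vertexSpace_eq_of_linearEquiv e]
  · rintro (⟨a, l⟩ | ⟨i, l⟩) v hv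
    · obtain ⟨e⟩ := (hF l).2
      rename_i i j
      change Fin (d i) → K at v
      change RepModule.single x i v ∈ F l.castSucc at hv
      change RepModule.single x j ((x.1 a).mulVec v) ∈ F l.succ
      have h1 : Ideal.Quotient.mk I (ofPath K ⟨i, j, a.toPath⟩) •
          ((F l.succ).submoduleOf (F l.castSucc)).mkQ ⟨_, hv⟩ = 0 := by
        apply e.injective
        rw [map_smul, map_zero]
        exact mk_ofPath_smul_eq_zero hI (by simp) _
      rw [← map_smul, Submodule.mkQ_apply, Submodule.Quotient.mk_eq_zero] at h1
      have h2 : Ideal.Quotient.mk I (ofPath K ⟨i, j, a.toPath⟩) • RepModule.single x i v ∈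
          F l.succ := h1
      rw [RepModule.mk_ofPath_smul, RepModule.single_apply_self] at h2
      simpa [Quiver.Hom.toPath, ArrowTuple.pathMatrix] using h2
    · change Fin (d i) → K at v
      change (1 : Matrix (Fin (d i)) (Fin (d i)) K).mulVec v ∈
        RepModule.component x (F l.castSucc) i
      rw [Matrix.one_mulVec]
      exact (hF l).1 hv

theorem mem_filt_of_hasSubrep (hI : IsAdmissibleIdeal I) (hS : S.dimVector = d)
    {x : RepVariety I d}
    (hx : HasSubrep (n := fun e => d e.1) S.stepDim (LayerArrow.rep x.1)) : x ∈ S.filt d := by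
  rw [hasSubrep_iff_exists_submodule fun e => hS ▸ S.stepDim_le_dimVector e] at hx
  obtain ⟨U, hU, hX⟩ := hx
  have harrow : ∀ {i j : V} (a : i ⟶ j) (l : Fin (loewyIndex I + 1)),
      ∀ v ∈ U (i, l.castSucc), (x.1 a).mulVec v ∈ U (j, l.succ) := fun a l =>
    hX (.arrow a l)
  have hmono : ∀ (i : V) (l : Fin (loewyIndex I + 1)), U (i, l.succ) ≤ U (i, l.castSucc) := by
    intro i l v hv
    have : (1 : Matrix (Fin (d i)) (Fin (d i)) K).mulVec v ∈ U (i, l.castSucc) :=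
      hX (.inclusion i l) v hv
    rwa [Matrix.one_mulVec] at this
  have hU' : ∀ i l, Module.finrank K (U (i, l)) = S.stepDim (i, l) := fun i l => hU (i, l)
  have hlast : ∀ i, U (i, Fin.last _) = ⊥ := fun i => by
    rw [← Submodule.finrank_eq_zero, hU, stepDim_last]
  have hzero : ∀ i, U (i, 0) = ⊤ := fun i => by
    apply Submodule.eq_top_of_finrank_eq
    rw [hU, stepDim_zero, hS, Module.finrank_fin_fun]
  -- a path of positive length factors through the next layer
  have hcons : ∀ {i j k : V} (p : Quiver.Path i j) (a : j ⟶ k) (l : Fin (loewyIndex I + 1)),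
      ∀ v ∈ U (i, l.castSucc), (x.1.pathMatrix (p.cons a)).mulVec v ∈ U (k, l.succ) := by
    intro i j k p
    induction p generalizing k with
    | nil =>
      intro a l v hv
      simpa [ArrowTuple.pathMatrix] using harrow a l v hv
    | cons p b ih =>
      intro a l v hv
      rw [ArrowTuple.pathMatrix, ← Matrix.mulVec_mulVec]
      exact harrow a l _ (hmono _ l (ih b l v hv))
  have hpath : ∀ {i j : V} (p : Quiver.Path i j) (l : Fin (loewyIndex I + 1 + 1)),
      ∀ v ∈ U (i, l), (x.1.pathMatrix p).mulVec v ∈ U (j, l) := by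
    intro i j p l v hv
    cases p with
    | nil => simpa [ArrowTuple.pathMatrix] using hv
    | cons p a =>
      induction l using Fin.lastCases with
      | last =>
        rw [hlast, Submodule.mem_bot] at hv
        rw [hv, Matrix.mulVec_zero]
        exact zero_mem _
      | cast l => exact hmono _ l (hcons p a l v hv)
  have hsingle_apply : ∀ l i, ∀ v ∈ U (i, l), ∀ j, RepModule.single x i v j ∈ U (j, l) := by
    intro l i v hv j
    by_cases hj : j = i
    · subst hj
      rwa [RepModule.single_apply_self]
    · rw [show RepModule.single x i v j = 0 from
        Pi.single_eq_of_ne (M := fun i : V => Fin (d i) → K) hj v]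
      exact zero_mem _
  let F : Fin (loewyIndex I + 1 + 1) → Submodule (PathAlgebra K V ⧸ I) (RepModule x) := fun l =>
    { carrier := {v | ∀ i, v i ∈ U (i, l)}
      add_mem' := fun hv hw i => add_mem (hv i) (hw i)
      zero_mem' := fun i => zero_mem _
      smul_mem' := by
        intro r v hv
        obtain ⟨r, rfl⟩ := Ideal.Quotient.mk_surjective r
        rw [Set.mem_ofPred_eq, RepModule.mk_smul]
        induction r using PathAlgebra.induction with
        | h0 => intro i; rw [map_zero]; exact zero_mem _
        | hadd r r' h h' => intro i; rw [map_add]; exact add_mem (h i) (h' i)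
        | hsmul c r h => intro i; rw [map_smul]; exact Submodule.smul_mem _ c (h i)
        | hpath p =>
          obtain ⟨j, k, p⟩ := p
          rw [← RepModule.mk_smul, RepModule.mk_ofPath_smul]
          exact hsingle_apply l k _ (hpath p l _ (hv j)) }
  have hmemF : ∀ l (v : RepModule x), v ∈ F l ↔ ∀ i, v i ∈ U (i, l) := fun l v => Iff.rfl
  have hsingle : ∀ l i (v : Fin (d i) → K), RepModule.single x i v ∈ F l ↔ v ∈ U (i, l) := by
    intro l i v
    rw [hmemF]
    refine ⟨fun h => ?_, hsingle_apply l i v⟩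
    simpa [RepModule.single_apply_self] using h i
  have hcomp : ∀ l i, RepModule.component x (F l) i = U (i, l) := fun l i =>
    Submodule.ext fun v => hsingle l i v
  have hle : ∀ l : Fin (loewyIndex I + 1), F l.succ ≤ F l.castSucc := fun l v hv i =>
    hmono i l (hv i)
  refine ⟨F, ?_, ?_, fun l => ⟨hle l, ?_⟩⟩
  · rw [eq_top_iff]
    intro v _ i
    rw [hzero]
    trivial
  · rw [eq_bot_iff]
    intro v hv
    refine (Submodule.mem_bot _).2 (funext fun i => ?_)
    have := hv i
    rwa [hlast] at this
  · refine nonempty_linearEquiv_of_finrank_vertexSpace_eq (K := K) ?_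
      (fun p hp v => mk_ofPath_smul_eq_zero hI hp v) fun i => ?_
    · rintro ⟨i, j, p⟩ hp w
      obtain ⟨⟨v, hv⟩, rfl⟩ := Submodule.mkQ_surjective _ w
      rw [← map_smul, Submodule.mkQ_apply, Submodule.Quotient.mk_eq_zero]
      change Ideal.Quotient.mk I (ofPath K ⟨i, j, p⟩) • v ∈ F l.succ
      rw [RepModule.mk_ofPath_smul, hsingle]
      cases p with
      | nil => simp at hp
      | cons p a => exact hcons p a l _ (hv i)
    · have := RepModule.finrank_vertexSpace_add_finrank_component (hle l) i
      rw [hcomp, hcomp, hU', hU', stepDim_castSucc] at this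
      exact Nat.add_right_cancel this

/-- `M_x` has a filtration governed by `𝕊` if and only if the representation of `Q × {0, …, L + 1}`
given by `x` has a subrepresentation with the dimensions of the terms of such a filtration. Only
these dimensions matter, since a semisimple module is determined by its dimension vector. -/
theorem mem_filt_iff (hI : IsAdmissibleIdeal I) (hS : S.dimVector = d) (x : RepVariety I d) :
    x ∈ S.filt d ↔ HasSubrep (n := fun e => d e.1) S.stepDim (LayerArrow.rep x.1) :=
  ⟨hasSubrep_of_mem_filt hI hS, mem_filt_of_hasSubrep hI hS⟩

/-! ### Stability and closedness of `Filt 𝕊` -/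

theorem smul_mem_filt (hI : IsAdmissibleIdeal I) (hS : S.dimVector = d)
    (g : ∀ i : V, GL (Fin (d i)) K) {x : RepVariety I d} (hx : x ∈ S.filt d) :
    g • x ∈ S.filt d := by
  rw [mem_filt_iff hI hS] at hx ⊢
  obtain ⟨b, c, hb, hX⟩ := hx
  have hg : ∀ i, ((g i)⁻¹).1 * (g i).1 = 1 := fun i => (g i).inv_mul
  refine ⟨fun e => (g e.1).1 * b e, fun e => c e * ((g e.1)⁻¹).1, fun e => ?_,
    fun τ p q hq hp => ?_⟩
  · rw [Matrix.mul_assoc, ← Matrix.mul_assoc _ (g e.1).1, hg, Matrix.one_mul, hb]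
  · rw [← hX τ p q hq hp]
    have : LayerArrow.rep (g • x).1 τ * (g τ.source.1).1 =
        (g τ.target.1).1 * LayerArrow.rep x.1 τ := by
      rcases τ with ⟨a, l⟩ | ⟨i, l⟩
      · rename_i i j
        change (g j).1 * x.1 a * ((g i)⁻¹).1 * (g i).1 = (g j).1 * x.1 a
        rw [Matrix.mul_assoc, hg, Matrix.mul_one]
      · exact (Matrix.one_mul (g i).1).trans (Matrix.mul_one (g i).1).symm
    simp only [Matrix.mul_assoc]
    rw [← Matrix.mul_assoc (LayerArrow.rep (g • x).1 τ), this, Matrix.mul_assoc (g τ.target.1).1,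
      ← Matrix.mul_assoc ((g τ.target.1)⁻¹).1, hg, Matrix.one_mul]

theorem isClosed_filt [IsAlgClosed K] (hI : IsAdmissibleIdeal I) (hS : S.dimVector = d) :
    IsClosed (S.filt d) := by
  let C : Set (ArrowTuple K d) :=
    {x | HasSubrep (n := fun e => d e.1) S.stepDim (LayerArrow.rep x)}
  have hfilt : S.filt d = Subtype.val ⁻¹' C := Set.ext fun x => mem_filt_iff hI hS x
  rw [hfilt]
  refine IsClosed.preimage continuous_subtype_val (ArrowTuple.isClosed_iff.2
    ⟨{f | ∀ y ∈ C, MvPolynomial.eval y.coord f = 0}, Set.Subset.antisymm (fun x hx => ?_)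
      fun x hx f hf => hf x hx⟩)
  -- the universal representation, with entries the coordinates
  let X : ∀ τ : LayerArrow V (loewyIndex I + 1), Matrix (Fin (d τ.target.1)) (Fin (d τ.source.1))
      (MvPolynomial (ArrowTuple.Coord d) K) :=
    LayerArrow.rep fun i j a => .of fun p q => MvPolynomial.X ⟨i, j, a, p, q⟩
  have hX : ∀ z : ArrowTuple.Coord d → K, (fun τ => (X τ).map (MvPolynomial.eval z)) =
      LayerArrow.rep fun i j a => .of fun p q => z ⟨i, j, a, p, q⟩ := by
    intro z
    funext τ
    rcases τ with ⟨a, l⟩ | ⟨i, l⟩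
    · ext p q
      exact MvPolynomial.eval_X _
    · exact Matrix.map_one (n := Fin (d i)) (MvPolynomial.eval z) (map_zero _) (map_one _)
  have := HasSubrep.eval_of_forall_eval_eq_zero (n := fun e : V × _ => d e.1) (D := S.stepDim) X
    x.coord fun f hf => hx f fun y hy => hf _ (by rw [hX]; exact hy)
  rw [hX] at this
  exact this

end SemisimpleSequence

end

theorem theorem3p8 {K : Type*} [Field K] [IsAlgClosed K]
    {V : Type*} [Fintype V] [DecidableEq V] [Quiver V] [∀ i j : V, Finite (i ⟶ j)]
    (I : Ideal (PathAlgebra K V)) [I.IsTwoSided] (hI : IsAdmissibleIdeal I)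
    (d : V → ℕ) (S : SemisimpleSequence I) (hS : S.dimVector = d) :
    (∀ (g : ∀ i : V, GL (Fin (d i)) K), ∀ x ∈ S.filt d, g • x ∈ S.filt d) ∧
      IsClosed (S.filt d) ∧
      closure (S.rep d) ⊆ S.filt d := by
  have hclosed := SemisimpleSequence.isClosed_filt hI hS
  exact ⟨fun g x hx => SemisimpleSequence.smul_mem_filt hI hS g hx, hclosed,
    closure_minimal (fun x hx => SemisimpleSequence.IsRadicalLayering.governsFiltration hI hx)
      hclosed⟩
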